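/- **Proposition 3.6.** Let $(M_1,g_1,J)$ be a Kähler manifold, that is, a smooth Riemannian manifold with a smooth $(1,1)$-tensor field $J$ such that $J^2=-I$, $g_1(JX,JY)=g_1(X,Y)$ and $(\nabla_XJ)Y=0$ for all smooth vector fields $X,Y$, where $\nabla$ is the Levi-Civita connection of $g_1$. Let $(M_2,g_2)$ be a Riemannian manifold and let $F:M_1\to M_2$ be a semi-invariant Riemannian submersion. This means that $F$ is smooth and surjective, each differential $F_{*p}$ is surjective and isometric on $(\ker F_{*p})^\perp$, and there is a smooth distribution $\mathcal D_1\subseteq\ker F_*$ such that, with $\mathcal D_2$ the orthogonal complement of $\mathcal D_1$ in $\ker F_*$, one has $\ker F_*=\mathcal D_1\oplus\mathcal D_2$, $J\mathcal D_1=\mathcal D_1$ and $J\mathcal D_2\subseteq(\ker F_*)^\perp$. Let $\mathcal V$ and $\mathcal H$ be the orthogonal projections onto $\ker F_*$ and $(\ker F_*)^\perp$. For a vertical field $V$ write $JV=\phi V+\omega V$ with $\phi V\in\mathcal D_1$ and $\omega V\in J\mathcal D_2$. Put $$\mathcal T_XY=\mathcal H\nabla_{\mathcal VX}\mathcal VY+\mathcal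 V\nabla_{\mathcal VX}\mathcal HY,\qquad \hat\nabla_VW=\mathcal V\nabla_VW$$ for vector fields $X,Y$ and vertical fields $V,W$. Then the distribution $\ker F_*$ defines a totally geodesic foliation (it is involutive, and the second fundamental form $(X,Y)\mapsto\mathcal H\nabla_XY$, $X,Y\in\Gamma(\ker F_*)$, of its leaves vanishes) if and only if, for all $X_1,X_2\in\Gamma(\ker F_*)$, $$\mathcal T_{X_1}\phi X_2+\mathcal H\nabla_{X_1}\omega X_2\in\Gamma(J\mathcal D_2)\quad\text{and}\quad\hat\nabla_{X_1}\phi X_2+\mathcal T_{X_1}\omega X_2\in\Gamma(\mathcal D_1).$$ -/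

import Mathlib

open Bundle Manifold VectorField
open scoped ContDiff InnerProductSpace

noncomputable section

namespace SemiInvariant

section LeviCivita

variable {E : Type*} [NormedAddCommGroup E] [NormedSpace ℝ E]
  {H : Type*} [TopologicalSpace H] (I : ModelWithCorners ℝ E H)
  {M : Type*} [TopologicalSpace M] [ChartedSpace H M] [IsManifold I ∞ M]
  [RiemannianBundle (fun x : M => TangentSpace I x)]

/-- The Koszul expression, half of
`X⟪Y,Z⟫ + Y⟪Z,X⟫ - Z⟪X,Y⟫ + ⟪[X,Y],Z⟫ - ⟪[Y,Z],X⟫ + ⟪[Z,X],Y⟫`, at the point `x`. -/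
def koszul (Y X Z : Π x : M, TangentSpace I x) (x : M) : ℝ :=
  (mvfderiv I (fun y => ⟪Y y, Z y⟫_ℝ) x (X x)
    + mvfderiv I (fun y => ⟪Z y, X y⟫_ℝ) x (Y x)
    - mvfderiv I (fun y => ⟪X y, Y y⟫_ℝ) x (Z x)
    + ⟪mlieBracket I X Y x, Z x⟫_ℝ
    - ⟪mlieBracket I Y Z x, X x⟫_ℝ
    + ⟪mlieBracket I Z X x, Y x⟫_ℝ) / 2

variable [IsContMDiffRiemannianBundle I ∞ E (fun x : M => TangentSpace I x)]

variable {I}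

theorem mdiffAt_inner {X Y : Π x : M, TangentSpace I x} {x : M}
    (hX : MDiffAt (T% X) x) (hY : MDiffAt (T% Y) x) :
    MDiffAt (fun y => ⟪X y, Y y⟫_ℝ) x :=
  MDifferentiableAt.inner_bundle (IB := I) (F := E) (E := fun x : M => TangentSpace I x) hX hY

variable [FiniteDimensional ℝ E]

theorem koszul_tensorial₂ {Y X : Π x : M, TangentSpace I x} {x : M}
    (hY : MDiffAt (T% Y) x) (hX : MDiffAt (T% X) x) :
    TensorialAt I E (fun Z => koszul I Y X Z x) x where
  smul {f Z} hf hZ := by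
    have e1 : (fun y => ⟪Y y, (f • Z) y⟫_ℝ) = fun y => f y * ⟪Y y, Z y⟫_ℝ := by
      ext y; simp [inner_smul_right]
    have e2 : (fun y => ⟪(f • Z) y, X y⟫_ℝ) = fun y => f y * ⟪Z y, X y⟫_ℝ := by
      ext y; simp [inner_smul_left]
    unfold koszul
    rw [e1, e2, mvfderiv_fun_mul hf (mdiffAt_inner hY hZ), mvfderiv_fun_mul hf (mdiffAt_inner hZ hX),
      mlieBracket_smul_left hf hZ, mlieBracket_smul_right hf hZ]
    simp [inner_add_left, inner_smul_left, inner_smul_right, real_inner_comm]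
    ring
  add {Z Z'} hZ hZ' := by
    have e1 : (fun y => ⟪Y y, (Z + Z') y⟫_ℝ) = fun y => ⟪Y y, Z y⟫_ℝ + ⟪Y y, Z' y⟫_ℝ := by
      ext y; simp [inner_add_right]
    have e2 : (fun y => ⟪(Z + Z') y, X y⟫_ℝ) = fun y => ⟪Z y, X y⟫_ℝ + ⟪Z' y, X y⟫_ℝ := by
      ext y; simp [inner_add_left]
    unfold koszul
    rw [e1, e2, mvfderiv_fun_add (mdiffAt_inner hY hZ) (mdiffAt_inner hY hZ'),
      mvfderiv_fun_add (mdiffAt_inner hZ hX) (mdiffAt_inner hZ' hX),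
      mlieBracket_add_left hZ hZ', mlieBracket_add_right hZ hZ']
    simp [inner_add_left, inner_add_right]
    ring

theorem koszul_tensorial₁ {Y Z : Π x : M, TangentSpace I x} {x : M}
    (hY : MDiffAt (T% Y) x) (hZ : MDiffAt (T% Z) x) :
    TensorialAt I E (fun X => koszul I Y X Z x) x where
  smul {f X} hf hX := by
    have e1 : (fun y => ⟪(f • X) y, Y y⟫_ℝ) = fun y => f y * ⟪X y, Y y⟫_ℝ := by
      ext y; simp [inner_smul_left]
    have e2 : (fun y => ⟪Z y, (f • X) y⟫_ℝ) = fun y => f y * ⟪Z y, X y⟫_ℝ := by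
      ext y; simp [inner_smul_right]
    unfold koszul
    rw [e1, e2, mvfderiv_fun_mul hf (mdiffAt_inner hX hY), mvfderiv_fun_mul hf (mdiffAt_inner hZ hX),
      mlieBracket_smul_left hf hX, mlieBracket_smul_right hf hX]
    simp [inner_add_left, inner_smul_left, inner_smul_right, real_inner_comm]
    ring
  add {X X'} hX hX' := by
    have e1 : (fun y => ⟪(X + X') y, Y y⟫_ℝ) = fun y => ⟪X y, Y y⟫_ℝ + ⟪X' y, Y y⟫_ℝ := by
      ext y; simp [inner_add_left]
    have e2 : (fun y => ⟪Z y, (X + X') y⟫_ℝ) = fun y => ⟪Z y, X y⟫_ℝ + ⟪Z y, X' y⟫_ℝ := by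
      ext y; simp [inner_add_right]
    unfold koszul
    rw [e1, e2, mvfderiv_fun_add (mdiffAt_inner hX hY) (mdiffAt_inner hX' hY),
      mvfderiv_fun_add (mdiffAt_inner hZ hX) (mdiffAt_inner hZ hX'),
      mlieBracket_add_left hX hX', mlieBracket_add_right hX hX']
    simp [inner_add_left, inner_add_right]
    ring

theorem koszul_add {Y Y' X Z : Π x : M, TangentSpace I x} {x : M}
    (hY : MDiffAt (T% Y) x) (hY' : MDiffAt (T% Y') x) (hX : MDiffAt (T% X) x)
    (hZ : MDiffAt (T% Z) x) :
    koszul I (Y + Y') X Z x = koszul I Y X Z x + koszul I Y' X Z x := by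
  have e1 : (fun y => ⟪(Y + Y') y, Z y⟫_ℝ) = fun y => ⟪Y y, Z y⟫_ℝ + ⟪Y' y, Z y⟫_ℝ := by
    ext y; simp [inner_add_left]
  have e2 : (fun y => ⟪X y, (Y + Y') y⟫_ℝ) = fun y => ⟪X y, Y y⟫_ℝ + ⟪X y, Y' y⟫_ℝ := by
    ext y; simp [inner_add_right]
  unfold koszul
  rw [e1, e2, mvfderiv_fun_add (mdiffAt_inner hY hZ) (mdiffAt_inner hY' hZ),
    mvfderiv_fun_add (mdiffAt_inner hX hY) (mdiffAt_inner hX hY'),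
    mlieBracket_add_left hY hY', mlieBracket_add_right hY hY']
  simp [inner_add_left, inner_add_right]
  ring

theorem koszul_leibniz {Y X Z : Π x : M, TangentSpace I x} {f : M → ℝ} {x : M}
    (hY : MDiffAt (T% Y) x) (hf : MDiffAt f x) (hX : MDiffAt (T% X) x) (hZ : MDiffAt (T% Z) x) :
    koszul I (f • Y) X Z x
      = f x * koszul I Y X Z x + mvfderiv I f x (X x) * ⟪Y x, Z x⟫_ℝ := by
  have e1 : (fun y => ⟪(f • Y) y, Z y⟫_ℝ) = fun y => f y * ⟪Y y, Z y⟫_ℝ := by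
    ext y; simp [inner_smul_left]
  have e2 : (fun y => ⟪X y, (f • Y) y⟫_ℝ) = fun y => f y * ⟪X y, Y y⟫_ℝ := by
    ext y; simp [inner_smul_right]
  unfold koszul
  rw [e1, e2, mvfderiv_fun_mul hf (mdiffAt_inner hY hZ), mvfderiv_fun_mul hf (mdiffAt_inner hX hY),
    mlieBracket_smul_left hf hY, mlieBracket_smul_right hf hY]
  simp [inner_add_left, inner_smul_left, inner_smul_right, real_inner_comm]
  ring

open scoped Classical in
/-- `leviCivitaFun Y x v` is `∇_v Y`, the vector with `⟪∇_v Y, Z⟫ = koszul Y X Z` for `X x = v`.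
Where `Y` is not differentiable it is set to zero. -/
def leviCivitaFun (Y : Π x : M, TangentSpace I x) (x : M) :
    TangentSpace I x →L[ℝ] TangentSpace I x :=
  haveI : FiniteDimensional ℝ (TangentSpace I x) := inferInstanceAs (FiniteDimensional ℝ E)
  if hY : MDiffAt (T% Y) x then
    (InnerProductSpace.toDual ℝ (TangentSpace I x)
        ).symm.toContinuousLinearEquiv.toContinuousLinearMap ∘L TensorialAt.mkHom₂ (fun X Z => koszul I Y X Z x) x
        (fun _ hZ => koszul_tensorial₁ hY hZ) (fun _ hX => koszul_tensorial₂ hY hX)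
  else 0

theorem inner_leviCivitaFun {Y X Z : Π x : M, TangentSpace I x} {x : M}
    (hY : MDiffAt (T% Y) x) (hX : MDiffAt (T% X) x) (hZ : MDiffAt (T% Z) x) :
    ⟪leviCivitaFun Y x (X x), Z x⟫_ℝ = koszul I Y X Z x := by
  have : FiniteDimensional ℝ (TangentSpace I x) := inferInstanceAs (FiniteDimensional ℝ E)
  rw [leviCivitaFun, dif_pos hY]
  refine Eq.trans ?_ (TensorialAt.mkHom₂_apply (Φ := fun X Z => koszul I Y X Z x) (x := x)
    (fun _ hZ => koszul_tensorial₁ hY hZ) (fun _ hX => koszul_tensorial₂ hY hX) hX hZ)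
  exact InnerProductSpace.toDual_symm_apply

theorem inner_leviCivitaFun_extend {Y : Π x : M, TangentSpace I x} {x : M}
    (hY : MDiffAt (T% Y) x) (v w : TangentSpace I x) :
    ⟪leviCivitaFun Y x v, w⟫_ℝ
      = koszul I Y (FiberBundle.extend E v) (FiberBundle.extend E w) x := by
  have := inner_leviCivitaFun hY (FiberBundle.mdifferentiableAt_extend I E v)
    (FiberBundle.mdifferentiableAt_extend I E w)
  simpa using this

variable (I M) in
/-- The Levi-Civita connection of the Riemannian metric of `M`, given by the Koszul formula.
In Mathlib's argument order, `leviCivita I M Y x v` is `∇_v Y`. -/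
def leviCivita : CovariantDerivative I E (fun x : M => TangentSpace I x) where
  toFun := leviCivitaFun
  isCovariantDerivativeOnUniv :=
    { add := by
        intro Y Y' x hY hY' _
        ext1 v
        refine ext_inner_right ℝ fun w => ?_
        rw [_root_.add_apply, inner_add_left,
          inner_leviCivitaFun_extend (mdifferentiableAt_add_section hY hY'),
          inner_leviCivitaFun_extend hY, inner_leviCivitaFun_extend hY']
        exact koszul_add hY hY' (FiberBundle.mdifferentiableAt_extend I E v)
          (FiberBundle.mdifferentiableAt_extend I E w)
      leibniz := by
        intro Y f x hY hf _
        ext1 v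
        refine ext_inner_right ℝ fun w => ?_
        rw [inner_leviCivitaFun_extend (hf.smul_section hY),
          koszul_leibniz hY hf (FiberBundle.mdifferentiableAt_extend I E v)
          (FiberBundle.mdifferentiableAt_extend I E w), ← inner_leviCivitaFun_extend hY]
        simp [inner_add_left, inner_smul_left] }

/-- `leviCivita` is torsion free. -/
theorem leviCivita_torsion : (leviCivita I M).torsion = 0 := by
  rw [CovariantDerivative.torsion_eq_zero_iff]
  intro X Y x hX hY
  refine ext_inner_right ℝ fun w => ?_
  have hW := FiberBundle.mdifferentiableAt_extend I E w
  have h1 := inner_leviCivitaFun hY hX hW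
  have h2 := inner_leviCivitaFun hX hY hW
  rw [FiberBundle.extend_apply_self] at h1 h2
  rw [inner_sub_left]
  refine (congrArg₂ (· - ·) h1 h2).trans ?_
  set W : Π x : M, TangentSpace I x := FiberBundle.extend E w with hWd
  have hw : w = W x := by simp [hWd]
  unfold koszul
  have s1 : (fun y => ⟪W y, X y⟫_ℝ) = fun y => ⟪X y, W y⟫_ℝ := by ext; exact real_inner_comm _ _
  have s2 : (fun y => ⟪W y, Y y⟫_ℝ) = fun y => ⟪Y y, W y⟫_ℝ := by ext; exact real_inner_comm _ _
  have s3 : (fun y => ⟪Y y, X y⟫_ℝ) = fun y => ⟪X y, Y y⟫_ℝ := by ext; exact real_inner_comm _ _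
  rw [s1, s2, s3, mlieBracket_swap_apply (V := Y) (W := X),
    mlieBracket_swap_apply (V := W) (W := X), mlieBracket_swap_apply (V := Y) (W := W), hw]
  simp only [inner_neg_left]
  ring

/-- `leviCivita` is compatible with the metric. -/
theorem leviCivita_metric {X Y Z : Π x : M, TangentSpace I x} {x : M}
    (hX : MDiffAt (T% X) x) (hY : MDiffAt (T% Y) x) (hZ : MDiffAt (T% Z) x) :
    mvfderiv I (fun y => ⟪Y y, Z y⟫_ℝ) x (X x)
      = ⟪leviCivita I M Y x (X x), Z x⟫_ℝ + ⟪Y x, leviCivita I M Z x (X x)⟫_ℝ := by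
  have h1 : ⟪leviCivita I M Y x (X x), Z x⟫_ℝ = _ := inner_leviCivitaFun hY hX hZ
  have h2 : ⟪leviCivita I M Z x (X x), Y x⟫_ℝ = _ := inner_leviCivitaFun hZ hX hY
  rw [real_inner_comm _ (Y x), h1, h2]
  unfold koszul
  have s1 : (fun y => ⟪Z y, X y⟫_ℝ) = fun y => ⟪X y, Z y⟫_ℝ := by ext; exact real_inner_comm _ _
  have s2 : (fun y => ⟪Z y, Y y⟫_ℝ) = fun y => ⟪Y y, Z y⟫_ℝ := by ext; exact real_inner_comm _ _
  have s3 : (fun y => ⟪Y y, X y⟫_ℝ) = fun y => ⟪X y, Y y⟫_ℝ := by ext; exact real_inner_comm _ _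
  rw [s1, s2, s3, mlieBracket_swap_apply (V := Y) (W := X),
    mlieBracket_swap_apply (V := Z) (W := X), mlieBracket_swap_apply (V := Y) (W := Z)]
  simp only [inner_neg_left]
  ring

end LeviCivita

section Submersion

variable {E : Type*} [NormedAddCommGroup E] [NormedSpace ℝ E]
  {H : Type*} [TopologicalSpace H] {I : ModelWithCorners ℝ E H}
  {M : Type*} [TopologicalSpace M] [ChartedSpace H M] [IsManifold I ∞ M]

/-- `X` is a smooth vector field on `M`. -/
def IsSmoothField (X : Π x : M, TangentSpace I x) : Prop :=
  ContMDiff I I.tangent ∞ (fun x => (⟨x, X x⟩ : TangentBundle I M))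

/-- `X ∈ Γ(D)`: a smooth vector field with values in the family of subspaces `D`. -/
def IsSectionOf (D : Π x : M, Submodule ℝ (TangentSpace I x))
    (X : Π x : M, TangentSpace I x) : Prop :=
  IsSmoothField X ∧ ∀ x, X x ∈ D x

/-- `D` is a smooth distribution: near every point it has a smooth local frame. -/
def IsSmoothDistribution (D : Π x : M, Submodule ℝ (TangentSpace I x)) : Prop :=
  ∀ p : M, ∃ U : Set M, IsOpen U ∧ p ∈ U ∧ ∃ (k : ℕ) (e : Fin k → Π x : M, TangentSpace I x),
    (∀ i, ContMDiffOn I I.tangent ∞ (fun x => (⟨x, e i x⟩ : TangentBundle I M)) U) ∧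
    ∀ x ∈ U, LinearIndependent ℝ (fun i => e i x) ∧
      Submodule.span ℝ (Set.range fun i => e i x) = D x

/-- `D` is closed under the Lie bracket, i.e. (Frobenius) it is tangent to a foliation. -/
def IsInvolutive (D : Π x : M, Submodule ℝ (TangentSpace I x)) : Prop :=
  ∀ X Y : Π x : M, TangentSpace I x, IsSectionOf D X → IsSectionOf D Y →
    ∀ x, mlieBracket I X Y x ∈ D x

variable [FiniteDimensional ℝ E]

instance (x : M) : FiniteDimensional ℝ (TangentSpace I x) :=
  inferInstanceAs (FiniteDimensional ℝ E)

variable [RiemannianBundle (fun x : M => TangentSpace I x)]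

/-- The part of a vector field `X` in the distribution `D`. -/
def tangentialPart (D : Π x : M, Submodule ℝ (TangentSpace I x))
    (X : Π x : M, TangentSpace I x) (x : M) : TangentSpace I x :=
  (D x).starProjection (X x)

/-- The part of a vector field `X` orthogonal to the distribution `D`. -/
def normalPart (D : Π x : M, Submodule ℝ (TangentSpace I x))
    (X : Π x : M, TangentSpace I x) (x : M) : TangentSpace I x :=
  (D x)ᗮ.starProjection (X x)

variable [IsContMDiffRiemannianBundle I ∞ E (fun x : M => TangentSpace I x)]

/-- The covariant derivative `∇_X Y` for the Levi-Civita connection. -/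
def nabla (X Y : Π x : M, TangentSpace I x) (x : M) : TangentSpace I x :=
  leviCivita I M Y x (X x)

/-- `D` defines a totally geodesic foliation: it is involutive, and the second fundamental form
`(X, Y) ↦ (∇_X Y)^⊥` of its leaves vanishes (`X` and `Y` tangent to the leaves). -/
def DefinesTotallyGeodesicFoliation (D : Π x : M, Submodule ℝ (TangentSpace I x)) : Prop :=
  IsInvolutive D ∧
    ∀ X Y : Π x : M, TangentSpace I x, IsSectionOf D X → IsSectionOf D Y →
      ∀ x, normalPart D (nabla X Y) x = 0

/-- `J` is an almost complex structure making the Riemannian manifold `M` almost Hermitian. -/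
structure IsAlmostHermitian (J : Π x : M, TangentSpace I x →L[ℝ] TangentSpace I x) : Prop where
  smooth : ContMDiff I (I.prod 𝓘(ℝ, E →L[ℝ] E)) ∞
    (fun x => TotalSpace.mk' (E →L[ℝ] E)
      (E := fun x : M => TangentSpace I x →L[ℝ] TangentSpace I x) x (J x))
  sq : ∀ (x : M) (v : TangentSpace I x), J x (J x v) = -v
  inner_map : ∀ (x : M) (v w : TangentSpace I x), ⟪J x v, J x w⟫_ℝ = ⟪v, w⟫_ℝ

/-- `M` with the complex structure `J` is a Kähler manifold: `(∇_X J) Y = 0`. -/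
structure IsKahler (J : Π x : M, TangentSpace I x →L[ℝ] TangentSpace I x) : Prop
    extends IsAlmostHermitian J where
  parallel : ∀ X Y : Π x : M, TangentSpace I x, IsSmoothField X → IsSmoothField Y →
    ∀ x, nabla X (fun y => J y (Y y)) x - J x (nabla X Y x) = 0

variable {E' : Type*} [NormedAddCommGroup E'] [NormedSpace ℝ E']
  {H' : Type*} [TopologicalSpace H'] (I) (I' : ModelWithCorners ℝ E' H')
  {M' : Type*} [TopologicalSpace M'] [ChartedSpace H' M']

/-- The vertical distribution `ker F_*` of a map `F`. -/
def kerDist (F : M → M') (x : M) : Submodule ℝ (TangentSpace I x) :=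
  LinearMap.ker (mfderiv I I' F x).toLinearMap

/-- `F` is a Riemannian submersion of `M` onto `M'`. -/
structure IsRiemannianSubmersion [RiemannianBundle (fun x : M' => TangentSpace I' x)]
    (F : M → M') : Prop where
  smooth : ContMDiff I I' ∞ F
  surjective : Function.Surjective F
  maximal_rank : ∀ x, Function.Surjective (mfderiv I I' F x)
  isometry_horizontal : ∀ (x : M) (v w : TangentSpace I x),
    v ∈ (kerDist I I' F x)ᗮ → w ∈ (kerDist I I' F x)ᗮ →
      ⟪mfderiv I I' F x v, mfderiv I I' F x w⟫_ℝ = ⟪v, w⟫_ℝ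

/-- The orthogonal complement `D₂` of `D₁` in `ker F_*`. -/
def complDist (F : M → M') (D₁ : Π x : M, Submodule ℝ (TangentSpace I x)) (x : M) :
    Submodule ℝ (TangentSpace I x) :=
  kerDist I I' F x ⊓ (D₁ x)ᗮ

/-- The family of subspaces `J D`. -/
def mapDist {I : ModelWithCorners ℝ E H} (J : Π x : M, TangentSpace I x →L[ℝ] TangentSpace I x)
    (D : Π x : M, Submodule ℝ (TangentSpace I x)) (x : M) : Submodule ℝ (TangentSpace I x) :=
  (D x).map (J x).toLinearMap

/-- `F` is a semi-invariant Riemannian submersion, with `ker F_* = D₁ ⊕ D₂`, where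
`J D₁ = D₁` and `J D₂` is horizontal. -/
structure IsSemiInvariantSubmersion [RiemannianBundle (fun x : M' => TangentSpace I' x)]
    (J : Π x : M, TangentSpace I x →L[ℝ] TangentSpace I x) (F : M → M')
    (D₁ : Π x : M, Submodule ℝ (TangentSpace I x)) : Prop
    extends IsRiemannianSubmersion I I' F where
  smooth_dist : IsSmoothDistribution D₁
  le_ker : ∀ x, D₁ x ≤ kerDist I I' F x
  map_eq : ∀ x, mapDist J D₁ x = D₁ x
  map_le : ∀ x, mapDist J (complDist I I' F D₁) x ≤ (kerDist I I' F x)ᗮ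

/-- `φ V`, the component of `J V` in `D₁`. For vertical `V`, `J V = φ V + ω V`. -/
def phi {I : ModelWithCorners ℝ E H} (J : Π x : M, TangentSpace I x →L[ℝ] TangentSpace I x)
    [RiemannianBundle (fun x : M => TangentSpace I x)]
    (D₁ : Π x : M, Submodule ℝ (TangentSpace I x)) (V : Π x : M, TangentSpace I x) :
    Π x : M, TangentSpace I x :=
  tangentialPart D₁ (fun x => J x (V x))

/-- `ω V`, the component of `J V` in `J D₂`. -/
def omega (J : Π x : M, TangentSpace I x →L[ℝ] TangentSpace I x) (F : M → M')
    (D₁ : Π x : M, Submodule ℝ (TangentSpace I x)) (V : Π x : M, TangentSpace I x) :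
    Π x : M, TangentSpace I x :=
  tangentialPart (mapDist J (complDist I I' F D₁)) (fun x => J x (V x))

/-- The vertical part `𝒱 X`. -/
def vert (F : M → M') (X : Π x : M, TangentSpace I x) : Π x : M, TangentSpace I x :=
  tangentialPart (kerDist I I' F) X

/-- The horizontal part `ℋ X`. -/
def hor (F : M → M') (X : Π x : M, TangentSpace I x) : Π x : M, TangentSpace I x :=
  normalPart (kerDist I I' F) X

/-- O'Neill's tensor `𝒯_X Y = ℋ ∇_{𝒱X} 𝒱Y + 𝒱 ∇_{𝒱X} ℋY`. -/
def oneillT (F : M → M') (X Y : Π x : M, TangentSpace I x) (x : M) : TangentSpace I x :=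
  hor I I' F (nabla (vert I I' F X) (vert I I' F Y)) x
    + vert I I' F (nabla (vert I I' F X) (hor I I' F Y)) x

/-- The connection `∇̂_V W = 𝒱 ∇_V W` on the vertical distribution. -/
def nablaHat (F : M → M') (V W : Π x : M, TangentSpace I x) : Π x : M, TangentSpace I x :=
  vert I I' F (nabla V W)

end Submersion

end SemiInvariant

end

open Bundle Manifold VectorField
open scoped ContDiff InnerProductSpace

namespace SemiInvariant

/-! Torsion-freeness makes `ker F_*` involutive once it is parallel along itself, so the left side
says only that `∇_X Y` is vertical for vertical `X, Y` (`definesTotallyGeodesicFoliation_iff`). The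
Kähler condition gives `J ∇_X Y = ∇_X φY + ∇_X ωY`; by the definition of `𝒯`, the horizontal and
vertical parts of this field are the two expressions on the right side. Finally `J` carries `ker
F_*` onto `D₁ ⊕ J D₂`, with `D₁` vertical and `J D₂` horizontal. Hence a vector `u` is vertical
exactly when `J u` has vertical part in `D₁` and horizontal part in `J D₂`
(`mem_iff_starProjection_complexStructure_mem`). The equivalence thus holds point by point and for
each pair of fields.

The analytic cost is in splitting `∇_X JY`: additivity of the connection needs `φY` and `ωY`
differentiable. This comes from Gram–Schmidt on a local frame of `D₁`
(`mdiffAt_tangentialPart_span`). -/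

theorem span_range_fin_succ {V : Type*} [AddCommGroup V] [Module ℝ V] {k : ℕ}
    (e : Fin (k + 1) → V) :
    Submodule.span ℝ (Set.range e)
      = Submodule.span ℝ (Set.range fun i => e (Fin.castSucc i))
        ⊔ Submodule.span ℝ {e (Fin.last k)} := by
  rw [← Submodule.span_union]
  congr 1
  ext v
  simp only [Set.mem_range, Set.mem_union, Set.mem_singleton_iff, Fin.exists_fin_succ']
  simp only [eq_comm]

/-! ### Linear algebra in a single tangent space -/

section InnerProductSpace

variable {V : Type*} [NormedAddCommGroup V] [InnerProductSpace ℝ V]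

/-- One Gram–Schmidt step: the projection onto a subspace enlarged by one vector. -/
theorem starProjection_sup_span_singleton [FiniteDimensional ℝ V] (K : Submodule ℝ V) (v w : V) :
    (K ⊔ Submodule.span ℝ {v}).starProjection w
      = K.starProjection w
        + ((⟪v - K.starProjection v, v - K.starProjection v⟫_ℝ)⁻¹
            * ⟪v - K.starProjection v, w⟫_ℝ) • (v - K.starProjection v) := by
  set u := v - K.starProjection v with hu
  have hPv : K.starProjection v ∈ K := K.starProjection_apply_mem v
  have hPw : K.starProjection w ∈ K := K.starProjection_apply_mem w
  have huK : ∀ z ∈ K, ⟪u, z⟫_ℝ = 0 := fun z hz => K.starProjection_inner_eq_zero v z hz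
  have hwK : ∀ z ∈ K, ⟪w - K.starProjection w, z⟫_ℝ = 0 :=
    fun z hz => K.starProjection_inner_eq_zero w z hz
  have key : ⟪w - (K.starProjection w + ((⟪u, u⟫_ℝ)⁻¹ * ⟪u, w⟫_ℝ) • u), u⟫_ℝ = 0 := by
    rw [inner_sub_left, inner_add_left, inner_smul_left, real_inner_comm u (K.starProjection w),
      huK _ hPw, real_inner_comm u w]
    -- If `v ∈ K` then `u = 0` and the correction term vanishes, so the formula needs no
    -- independence assumption.
    rcases eq_or_ne ⟪u, u⟫_ℝ 0 with h | h
    · have : u = 0 := inner_self_eq_zero.mp h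
      simp [this]
    · simp only [RCLike.conj_to_real]
      field_simp
      ring
  have keyK : ∀ z ∈ K, ⟪w - (K.starProjection w + ((⟪u, u⟫_ℝ)⁻¹ * ⟪u, w⟫_ℝ) • u), z⟫_ℝ = 0 := by
    intro z hz
    rw [← sub_sub, inner_sub_left, hwK z hz, inner_smul_left, huK z hz]
    simp
  refine Submodule.eq_starProjection_of_mem_of_inner_eq_zero ?_ ?_
  · have hKle : K ≤ K ⊔ Submodule.span ℝ {v} := le_sup_left
    have hv : v ∈ K ⊔ Submodule.span ℝ {v} :=
      (le_sup_right : _ ≤ K ⊔ Submodule.span ℝ {v}) (Submodule.mem_span_singleton_self v)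
    exact add_mem (hKle hPw) (Submodule.smul_mem _ _ (sub_mem hv (hKle hPv)))
  · intro z hz
    obtain ⟨a, ha, b, hb, rfl⟩ := Submodule.mem_sup.mp hz
    obtain ⟨c, rfl⟩ := Submodule.mem_span_singleton.mp hb
    -- Orthogonality to `v` reduces to orthogonality to `u` and to `K`.
    have hvu : v = u + K.starProjection v := by simp [hu]
    rw [inner_add_right, keyK a ha, inner_smul_right, hvu, inner_add_right, key, keyK _ hPv]
    simp

variable {K D : Submodule ℝ V} {J : V →ₗ[ℝ] V}

/-- A vector of `K` is the sum of its components in `D` and in the complement of `D` in `K`. -/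
theorem exists_add_mem_inf_orthogonal [FiniteDimensional ℝ V] (hDK : D ≤ K) {v : V} (hv : v ∈ K) :
    ∃ a ∈ D, ∃ b ∈ K ⊓ Dᗮ, v = a + b :=
  ⟨D.starProjection v, D.starProjection_apply_mem v, v - D.starProjection v,
    ⟨sub_mem hv (hDK (D.starProjection_apply_mem v)), D.sub_starProjection_mem_orthogonal v⟩,
    by simp⟩

/-- For `v = a + b` split along `D`, the vectors `J a` and `J b` lie in the two target subspaces.
These are orthogonal, one being inside `K` and the other inside `Kᗮ`, so `J a` and `J b` are the two
projections. -/
theorem starProjection_add_starProjection_map [FiniteDimensional ℝ V] (hDK : D ≤ K)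
    (hJD : D.map J = D) (hJD' : (K ⊓ Dᗮ).map J ≤ Kᗮ) {v : V} (hv : v ∈ K) :
    D.starProjection (J v) + ((K ⊓ Dᗮ).map J).starProjection (J v) = J v := by
  obtain ⟨a, ha, b, hb, rfl⟩ := exists_add_mem_inf_orthogonal hDK hv
  have hJa : J a ∈ D := hJD ▸ Submodule.mem_map_of_mem ha
  have hJb : J b ∈ (K ⊓ Dᗮ).map J := Submodule.mem_map_of_mem hb
  have h1 : J b ∈ Dᗮ := Submodule.orthogonal_le hDK (hJD' hJb)
  have h2 : J a ∈ ((K ⊓ Dᗮ).map J)ᗮ :=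
    Submodule.orthogonal_le hJD' (K.le_orthogonal_orthogonal (hDK hJa))
  rw [Submodule.eq_starProjection_of_mem_orthogonal' hJa h1 (map_add J a b),
    Submodule.eq_starProjection_of_mem_orthogonal' hJb h2 (by rw [map_add, add_comm]), map_add]

/-- The right side says that `J u` lies in `D ⊕ J(K ⊓ Dᗮ) = J K`, and `J` is injective because `J² =
-1`. -/
theorem mem_iff_starProjection_complexStructure_mem [FiniteDimensional ℝ V] (hDK : D ≤ K)
    (hJ : ∀ v, J (J v) = -v) (hJD : D.map J = D) (hJD' : (K ⊓ Dᗮ).map J ≤ Kᗮ) (u : V) :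
    u ∈ K ↔ Kᗮ.starProjection (J u) ∈ (K ⊓ Dᗮ).map J ∧ K.starProjection (J u) ∈ D := by
  constructor
  · intro hu
    obtain ⟨a, ha, b, hb, rfl⟩ := exists_add_mem_inf_orthogonal hDK hu
    have hJa : J a ∈ D := hJD ▸ Submodule.mem_map_of_mem ha
    have hJb : J b ∈ (K ⊓ Dᗮ).map J := Submodule.mem_map_of_mem hb
    rw [Submodule.eq_starProjection_of_mem_orthogonal' (hDK hJa) (hJD' hJb) (map_add J a b),
      Submodule.eq_starProjection_of_mem_orthogonal' (hJD' hJb)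
        (K.le_orthogonal_orthogonal (hDK hJa)) (by rw [map_add, add_comm])]
    exact ⟨hJb, hJa⟩
  · rintro ⟨⟨b, hb, hb'⟩, ha⟩
    have hJa : J (K.starProjection (J u)) ∈ D := by
      have := Submodule.mem_map_of_mem (f := J) ha
      rwa [hJD] at this
    -- Applying `J` to the splitting of `J u` recovers `-u`; the horizontal part `J b` contributes
    -- `J (J b) = -b`.
    have hsum : J (J u) = J (K.starProjection (J u)) + -b := by
      rw [← hJ b, hb', ← map_add, Submodule.starProjection_add_starProjection_orthogonal]
    have hu : u = b - J (K.starProjection (J u)) := by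
      rw [hJ u] at hsum
      linear_combination (norm := module) (-1 : ℝ) • hsum
    rw [hu]
    exact sub_mem hb.1 (hDK hJa)

end InnerProductSpace

/-! ### Fields, projections and the connection on the manifold -/

section Manifold

variable {E : Type*} [NormedAddCommGroup E] [NormedSpace ℝ E]
  {H : Type*} [TopologicalSpace H] {I : ModelWithCorners ℝ E H}
  {M : Type*} [TopologicalSpace M] [ChartedSpace H M]

section

variable [IsManifold I ∞ M]

theorem IsSmoothField.mdiffAt {X : Π x : M, TangentSpace I x} (hX : IsSmoothField X) (p : M) :
    MDiffAt (T% X) p :=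
  (hX p).mdifferentiableAt (by simp)

variable [RiemannianBundle (fun x : M => TangentSpace I x)]

theorem IsAlmostHermitian.isSmoothField_apply
    {J : Π x : M, TangentSpace I x →L[ℝ] TangentSpace I x} (hJ : IsAlmostHermitian J)
    {X : Π x : M, TangentSpace I x} (hX : IsSmoothField X) :
    IsSmoothField (fun x => J x (X x)) :=
  fun p => (hJ.smooth p).clm_bundle_apply (hX p)

end

variable [FiniteDimensional ℝ E] [RiemannianBundle (fun x : M => TangentSpace I x)]

theorem tangentialPart_congr {D D' : Π x : M, Submodule ℝ (TangentSpace I x)}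
    {X : Π x : M, TangentSpace I x} {x : M} (h : D x = D' x) :
    tangentialPart D X x = tangentialPart D' X x := by
  simp only [tangentialPart, h]

theorem tangentialPart_eq_self {D : Π x : M, Submodule ℝ (TangentSpace I x)}
    {X : Π x : M, TangentSpace I x} (hX : ∀ x, X x ∈ D x) : tangentialPart D X = X :=
  funext fun x => Submodule.starProjection_eq_self_iff.mpr (hX x)

theorem tangentialPart_eq_zero {D : Π x : M, Submodule ℝ (TangentSpace I x)}
    {X : Π x : M, TangentSpace I x} (hX : ∀ x, X x ∈ (D x)ᗮ) : tangentialPart D X = 0 :=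
  funext fun x => (Submodule.starProjection_apply_eq_zero_iff _).mpr (hX x)

theorem normalPart_eq_self {D : Π x : M, Submodule ℝ (TangentSpace I x)}
    {X : Π x : M, TangentSpace I x} (hX : ∀ x, X x ∈ (D x)ᗮ) : normalPart D X = X :=
  funext fun x => Submodule.starProjection_eq_self_iff.mpr (hX x)

theorem normalPart_eq_zero {D : Π x : M, Submodule ℝ (TangentSpace I x)}
    {X : Π x : M, TangentSpace I x} (hX : ∀ x, X x ∈ D x) : normalPart D X = 0 :=
  funext fun x => (Submodule.starProjection_apply_eq_zero_iff _).mpr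
    ((D x).le_orthogonal_orthogonal (hX x))

theorem normalPart_apply_eq_zero_iff {D : Π x : M, Submodule ℝ (TangentSpace I x)}
    {X : Π x : M, TangentSpace I x} {x : M} : normalPart D X x = 0 ↔ X x ∈ D x := by
  rw [normalPart, Submodule.starProjection_apply_eq_zero_iff, Submodule.orthogonal_orthogonal]

variable {E' : Type*} [NormedAddCommGroup E'] [NormedSpace ℝ E']
  {H' : Type*} [TopologicalSpace H'] {I' : ModelWithCorners ℝ E' H'}
  {M' : Type*} [TopologicalSpace M'] [ChartedSpace H' M'] {F : M → M'}
  {X Y : Π x : M, TangentSpace I x}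

section

variable [IsManifold I ∞ M] [RiemannianBundle (fun x : M' => TangentSpace I' x)]
  {J : Π x : M, TangentSpace I x →L[ℝ] TangentSpace I x}
  {D₁ : Π x : M, Submodule ℝ (TangentSpace I x)}

theorem IsSemiInvariantSubmersion.phi_add_omega (hF : IsSemiInvariantSubmersion I I' J F D₁)
    (hX : ∀ x, X x ∈ kerDist I I' F x) :
    phi J D₁ X + omega I I' J F D₁ X = fun x => J x (X x) :=
  funext fun x => starProjection_add_starProjection_map (J := (J x).toLinearMap) (hF.le_ker x)
    (hF.map_eq x) (hF.map_le x) (hX x)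

theorem IsSemiInvariantSubmersion.phi_mem_kerDist (hF : IsSemiInvariantSubmersion I I' J F D₁)
    (x : M) : phi J D₁ X x ∈ kerDist I I' F x :=
  hF.le_ker x (Submodule.starProjection_apply_mem _ _)

theorem IsSemiInvariantSubmersion.omega_mem_orthogonal
    (hF : IsSemiInvariantSubmersion I I' J F D₁) (x : M) :
    omega I I' J F D₁ X x ∈ (kerDist I I' F x)ᗮ :=
  hF.map_le x (Submodule.starProjection_apply_mem _ _)

end

variable [IsManifold I ∞ M] [IsContMDiffRiemannianBundle I ∞ E (fun x : M => TangentSpace I x)]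

/-- The orthogonal projection of a differentiable field to the span of a local frame is
differentiable. -/
theorem mdiffAt_tangentialPart_span {p : M} {k : ℕ} {e : Fin k → Π x : M, TangentSpace I x}
    (he : ∀ i, MDiffAt (T% (e i)) p) (hli : LinearIndependent ℝ fun i => e i p)
    {X : Π x : M, TangentSpace I x} (hX : MDiffAt (T% X) p) :
    MDiffAt (T% (tangentialPart (fun x => Submodule.span ℝ (Set.range fun i => e i x)) X)) p := by
  induction k generalizing X with
  | zero =>
    have h0 : tangentialPart (fun x => Submodule.span ℝ (Set.range fun i => e i x)) X
        = fun _ => 0 := by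
      funext x
      exact (Submodule.starProjection_apply_eq_zero_iff _).mpr (by simp)
    rw [h0]
    exact mdifferentiableAt_zeroSection ℝ _
  | succ k ih =>
    -- The induction hypothesis is needed for two fields, `X` and the last frame vector, hence
    -- `generalizing X`.
    set P : (Π x : M, TangentSpace I x) → Π x : M, TangentSpace I x :=
      tangentialPart (fun x => Submodule.span ℝ (Set.range fun i => e (Fin.castSucc i) x)) with hP
    have hli' := linearIndependent_finSucc'.mp hli
    have hPX : ∀ {Y : Π x : M, TangentSpace I x}, MDiffAt (T% Y) p → MDiffAt (T% (P Y)) p :=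
      fun hY => ih (fun i => he _) hli'.1 hY
    set u : Π x : M, TangentSpace I x := e (Fin.last k) - P (e (Fin.last k)) with hu
    have hud : MDiffAt (T% u) p := mdifferentiableAt_sub_section (he _) (hPX (he _))
    -- Independence of the frame enters only here: it makes the inverse of `⟪u, u⟫` differentiable
    -- at `p`.
    have hu0 : ⟪u p, u p⟫_ℝ ≠ 0 := by
      intro h
      have h' : e (Fin.last k) p - P (e (Fin.last k)) p = 0 := inner_self_eq_zero.mp h
      apply hli'.2
      rw [sub_eq_zero] at h'
      change e (Fin.last k) p ∈ Submodule.span ℝ (Set.range fun i => e (Fin.castSucc i) p)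
      rw [h']
      exact Submodule.starProjection_apply_mem _ _
    -- Valid at every `x`, even where the frame degenerates, since the Gram–Schmidt step allows `u x
    -- = 0`.
    have key : tangentialPart (fun x => Submodule.span ℝ (Set.range fun i => e i x)) X
        = P X + ((fun x => (⟪u x, u x⟫_ℝ)⁻¹) * fun x => ⟪u x, X x⟫_ℝ) • u := by
      funext x
      rw [tangentialPart_congr (D' := fun x =>
        Submodule.span ℝ (Set.range fun i => e (Fin.castSucc i) x)
          ⊔ Submodule.span ℝ {e (Fin.last k) x}) (span_range_fin_succ fun i => e i x)]
      exact starProjection_sup_span_singleton _ _ _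
    rw [key]
    exact mdifferentiableAt_add_section (hPX hX)
      ((((mdiffAt_inner hud hud).inv hu0).mul (mdiffAt_inner hud hX)).smul_section hud)

/-- Applied to `D₁` and `J Y`, this gives differentiability of `φY`. -/
theorem IsSmoothDistribution.mdiffAt_tangentialPart
    {D : Π x : M, Submodule ℝ (TangentSpace I x)} (hD : IsSmoothDistribution D)
    {X : Π x : M, TangentSpace I x} {p : M} (hX : MDiffAt (T% X) p) :
    MDiffAt (T% (tangentialPart D X)) p := by
  obtain ⟨U, hU, hp, k, e, he, hspan⟩ := hD p
  have hd := mdiffAt_tangentialPart_span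
    (fun i => ((he i).contMDiffAt (hU.mem_nhds hp)).mdifferentiableAt (by simp))
    (hspan p hp).1 hX
  refine hd.congr_of_eventuallyEq ?_
  filter_upwards [hU.mem_nhds hp] with x hx
  exact congrArg (TotalSpace.mk x) (tangentialPart_congr (hspan x hx).2.symm)

theorem nabla_add_right {X Y Z : Π x : M, TangentSpace I x} {x : M}
    (hY : MDiffAt (T% Y) x) (hZ : MDiffAt (T% Z) x) :
    nabla X (Y + Z) x = nabla X Y x + nabla X Z x := by
  rw [nabla, (leviCivita I M).isCovariantDerivativeOnUniv.add hY hZ]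
  rfl

theorem nabla_zero_right (X : Π x : M, TangentSpace I x) :
    nabla X (0 : Π x : M, TangentSpace I x) = 0 := by
  funext x
  rw [nabla, CovariantDerivative.zero]
  rfl

theorem mlieBracket_eq_nabla_sub {X Y : Π x : M, TangentSpace I x} {x : M}
    (hX : MDiffAt (T% X) x) (hY : MDiffAt (T% Y) x) :
    mlieBracket I X Y x = nabla X Y x - nabla Y X x :=
  ((leviCivita I M).torsion_eq_zero_iff.mp leviCivita_torsion hX hY).symm

/-- By torsion-freeness, a distribution defines a totally geodesic foliation as soon as it is
parallel along itself. -/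
theorem definesTotallyGeodesicFoliation_iff {D : Π x : M, Submodule ℝ (TangentSpace I x)} :
    DefinesTotallyGeodesicFoliation D ↔
      ∀ X Y : Π x : M, TangentSpace I x, IsSectionOf D X → IsSectionOf D Y →
        ∀ x, nabla X Y x ∈ D x := by
  constructor
  · exact fun h X Y hX hY x => normalPart_apply_eq_zero_iff.mp (h.2 X Y hX hY x)
  · refine fun h => ⟨fun X Y hX hY x => ?_,
      fun X Y hX hY x => normalPart_apply_eq_zero_iff.mpr (h X Y hX hY x)⟩
    rw [mlieBracket_eq_nabla_sub (hX.1.mdiffAt x) (hY.1.mdiffAt x)]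
    exact sub_mem (h X Y hX hY x) (h Y X hY hX x)

/-- One of the two terms of `𝒯` differentiates the zero field: `ℋY` here, `𝒱Y` in the horizontal
case. -/
theorem oneillT_of_vertical (hX : ∀ x, X x ∈ kerDist I I' F x) (hY : ∀ x, Y x ∈ kerDist I I' F x) :
    oneillT I I' F X Y = hor I I' F (nabla X Y) := by
  funext x
  simp only [oneillT, vert, hor]
  rw [tangentialPart_eq_self hX, tangentialPart_eq_self hY, normalPart_eq_zero hY,
    nabla_zero_right]
  simp [tangentialPart]

theorem oneillT_of_horizontal (hX : ∀ x, X x ∈ kerDist I I' F x)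
    (hY : ∀ x, Y x ∈ (kerDist I I' F x)ᗮ) :
    oneillT I I' F X Y = vert I I' F (nabla X Y) := by
  funext x
  simp only [oneillT, vert, hor]
  rw [tangentialPart_eq_self hX, tangentialPart_eq_zero hY, normalPart_eq_self hY,
    nabla_zero_right]
  simp [normalPart]

variable [RiemannianBundle (fun x : M' => TangentSpace I' x)]
  {J : Π x : M, TangentSpace I x →L[ℝ] TangentSpace I x}
  {D₁ : Π x : M, Submodule ℝ (TangentSpace I x)}

/-- For vertical `X, Y`, the field `∇_X φY + ∇_X ωY` is `J ∇_X Y`. -/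
theorem IsSemiInvariantSubmersion.nabla_phi_add_nabla_omega (hJ : IsKahler J)
    (hF : IsSemiInvariantSubmersion I I' J F D₁) (hX : IsSmoothField X)
    (hY : IsSectionOf (kerDist I I' F) Y) (x : M) :
    nabla X (phi J D₁ Y) x + nabla X (omega I I' J F D₁ Y) x = J x (nabla X Y x) := by
  have hJY := (hJ.isSmoothField_apply hY.1).mdiffAt x
  have hphi : MDiffAt (T% (phi J D₁ Y)) x := hF.smooth_dist.mdiffAt_tangentialPart hJY
  have hsum := hF.phi_add_omega hY.2
  -- Writing `ωY = JY - φY` avoids having to show that `J D₂` is a smooth distribution.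
  have homega : MDiffAt (T% (omega I I' J F D₁ Y)) x := by
    rw [eq_sub_of_add_eq' hsum]
    exact mdifferentiableAt_sub_section hJY hphi
  rw [← nabla_add_right hphi homega, hsum]
  exact sub_eq_zero.mp (hJ.parallel X Y hX hY.1 x)

theorem IsSemiInvariantSubmersion.nabla_mem_kerDist_iff (hJ : IsKahler J)
    (hF : IsSemiInvariantSubmersion I I' J F D₁) (hX : IsSectionOf (kerDist I I' F) X)
    (hY : IsSectionOf (kerDist I I' F) Y) (x : M) :
    nabla X Y x ∈ kerDist I I' F x ↔
      oneillT I I' F X (phi J D₁ Y) x + hor I I' F (nabla X (omega I I' J F D₁ Y)) x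
          ∈ mapDist J (complDist I I' F D₁) x ∧
        nablaHat I I' F X (phi J D₁ Y) x + oneillT I I' F X (omega I I' J F D₁ Y) x ∈ D₁ x := by
  rw [oneillT_of_vertical hX.2 hF.phi_mem_kerDist, oneillT_of_horizontal hX.2
    hF.omega_mem_orthogonal]
  simp only [nablaHat, hor, vert, normalPart, tangentialPart]
  -- By linearity of the projections, the two sums become the horizontal and vertical parts of `J
  -- ∇_X Y`.
  rw [← map_add, ← map_add, hF.nabla_phi_add_nabla_omega hJ hX.1 hY x]
  exact mem_iff_starProjection_complexStructure_mem (J := (J x).toLinearMap) (hF.le_ker x)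
    (hJ.sq x) (hF.map_eq x) (hF.map_le x) _

end Manifold

end SemiInvariant

theorem proposition3p6
    {E₁ : Type*} [NormedAddCommGroup E₁] [NormedSpace ℝ E₁] [FiniteDimensional ℝ E₁]
    {H₁ : Type*} [TopologicalSpace H₁] (I₁ : ModelWithCorners ℝ E₁ H₁)
    {M₁ : Type*} [TopologicalSpace M₁] [T2Space M₁] [SecondCountableTopology M₁]
    [ChartedSpace H₁ M₁] [IsManifold I₁ ∞ M₁] [BoundarylessManifold I₁ M₁]
    [RiemannianBundle (fun x : M₁ => TangentSpace I₁ x)]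
    [IsContMDiffRiemannianBundle I₁ ∞ E₁ (fun x : M₁ => TangentSpace I₁ x)]
    {E₂ : Type*} [NormedAddCommGroup E₂] [NormedSpace ℝ E₂] [FiniteDimensional ℝ E₂]
    {H₂ : Type*} [TopologicalSpace H₂] (I₂ : ModelWithCorners ℝ E₂ H₂)
    {M₂ : Type*} [TopologicalSpace M₂] [T2Space M₂] [SecondCountableTopology M₂]
    [ChartedSpace H₂ M₂] [IsManifold I₂ ∞ M₂] [BoundarylessManifold I₂ M₂]
    [RiemannianBundle (fun x : M₂ => TangentSpace I₂ x)]
    [IsContMDiffRiemannianBundle I₂ ∞ E₂ (fun x : M₂ => TangentSpace I₂ x)]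
    (J : Π x : M₁, TangentSpace I₁ x →L[ℝ] TangentSpace I₁ x)
    (hJ : SemiInvariant.IsKahler J)
    (F : M₁ → M₂) (D₁ : Π x : M₁, Submodule ℝ (TangentSpace I₁ x))
    (hF : SemiInvariant.IsSemiInvariantSubmersion I₁ I₂ J F D₁) :
    SemiInvariant.DefinesTotallyGeodesicFoliation (SemiInvariant.kerDist I₁ I₂ F) ↔
      ∀ X₁ X₂ : Π x : M₁, TangentSpace I₁ x,
        SemiInvariant.IsSectionOf (SemiInvariant.kerDist I₁ I₂ F) X₁ →
        SemiInvariant.IsSectionOf (SemiInvariant.kerDist I₁ I₂ F) X₂ →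
        (∀ x, SemiInvariant.oneillT I₁ I₂ F X₁ (SemiInvariant.phi J D₁ X₂) x
            + SemiInvariant.hor I₁ I₂ F
                (SemiInvariant.nabla X₁ (SemiInvariant.omega I₁ I₂ J F D₁ X₂)) x
          ∈ SemiInvariant.mapDist J (SemiInvariant.complDist I₁ I₂ F D₁) x) ∧
        (∀ x, SemiInvariant.nablaHat I₁ I₂ F X₁ (SemiInvariant.phi J D₁ X₂) x
            + SemiInvariant.oneillT I₁ I₂ F X₁ (SemiInvariant.omega I₁ I₂ J F D₁ X₂) x
          ∈ D₁ x) := by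
  rw [SemiInvariant.definesTotallyGeodesicFoliation_iff]
  refine forall₂_congr fun X Y => forall₂_congr fun hX hY => ?_
  rw [← forall_and]
  exact forall_congr' fun x => hF.nabla_mem_kerDist_iff hJ hX hY x
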